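/- **Model.** For a sequence $y_t\in\{0,1\}$ ($t\ge 1$) and parameters $a_t>-1$, let $G_0,G_1,\dots$ be the following random multigraphs (loops and multiple edges allowed). $G_0$ is a single isolated vertex, whose degree is counted as one (this extra unit is kept in its degree at all later times). Given $G_{t-1}$: if $y_t=1$ (vertex-step), a new vertex is added together with an edge joining it to an existing vertex $u$ chosen with probability proportional to $d(u)+a_t$, where $d(u)$ is the degree of $u$ in $G_{t-1}$; if $y_t=0$ (edge-step), an edge $\{u,w\}$ is added, where $u,w$ are existing vertices chosen independently with probability proportional to $d(\cdot)+a_t$ (a loop, counted twice in the degree, if $u=w$). Let $v_t=1+\sum_{i\le t}y_i$ be the number of vertices of $G_t$, $x_t$ the number of vertices of degree one in $G_t$, and $\Gamma_t=\sigma(x_0,\dots,x_t)$. For $S\le t$ and $b>-1$ let $f_{S,t}(b)$ be the conditional expectation $E(x_t\mid\Gamma_S)$ computed in the model in which $a_s$ is replaced by $b$ for all $s\in[S,t]$. **Theorem.** For each horizon $T\in\mathbb N$ consider this model on $[0,T]$; the known (non-random) $y_t$, the bounded parameters $a_t>-1$ and the integers $S,R$ may all depend on $T$. Suppose that there is $p>0$,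 independent of $T$, with $v_t/t\ge p$ for all $t>0$, and that, for all large $T$, $0\le S<R<T$, $a_t=\alpha_1$ for $t\in[S,R)$ and $a_t=\alpha_2$ for $t\in[R,T]$, where $\alpha_1\ne\alpha_2$ do not depend on $T$. Suppose that the limits $\lim_{T\to\infty}(T-R)/T$ and $\lim_{T\to\infty}(R-S)/T$ exist and are positive. Let $\hat a>-1$ be an estimator that is a minimizer of $b\mapsto(f_{S,T}(b)-x_T)^2$ over $(-1,\infty)$ whenever a minimizer exists. Put $$h(t)=|E(x_t\mid\Gamma_S)-f_{S,t}(\hat a)|,\qquad t\in[S,T],$$ let $\hat R$ be a maximizer of $h$ over the integers of $(S,T)$, and assume that for some constant $c>0$ (independent of $T$), with probability tending to one as $T\to\infty$, $$h(\hat R)-h(t)\ge c\,|t-\hat R|\qquad\text{for all integers } S\le t\le T .$$ Let $\hat m_t=\frac{1+\hat a}{2t-1+\hat a v_{t-1}}$, $\hat x_S=x_S$, $\hat x_t=(1-\hat m_t)\,[1-(1-y_t)\hat m_t]\,\hat x_{t-1}+y_t$ for $S<t\le T$, and let $$\hat\tau=\arg\max_{t\in(S,T)}|\hat x_t-x_t|+1$$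 (the arg max is over the integers of $(S,T)$; any maximizer may be taken in case of ties). Then $$\frac{|\hat\tau-1-\hat R|}{T}=O_p\!\left(\frac{\log T}{T^{1/2}}\right)\qquad(T\to\infty),$$ that is, for every $\varepsilon>0$ there is $M>0$ such that $P\big(|\hat\tau-1-\hat R|/T>M\,T^{-1/2}\log T\big)\le\varepsilon$ for all sufficiently large $T$. -/

import Mathlib

open MeasureTheory Filter Topology

namespace PrefAttach

/-- A finite undirected multigraph (loops and repeated edges allowed) whose vertices are
`0, 1, …, numV - 1`, in order of appearance. -/
@[ext]
structure MGraph where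
  /-- the number of vertices -/
  numV : ℕ
  /-- the edges, with multiplicity -/
  edges : Multiset (Sym2 ℕ)

/-- The initial graph: the single vertex `0` and no edge. -/
def MGraph.init : MGraph := ⟨1, 0⟩

/-- The degree of a vertex: the number of edge ends at `u` (a loop counts twice). The initial
vertex `0` has degree one in the initial graph by convention, hence the last summand. -/
def MGraph.degree (G : MGraph) (u : ℕ) : ℕ :=
  G.edges.countP (fun e => u ∈ e) + G.edges.count s(u, u) + (if u = 0 then 1 else 0)

/-- The number of leaves, that is of vertices of degree one. -/
def MGraph.numLeaves (G : MGraph) : ℕ :=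
  ((Finset.range G.numV).filter (fun u => G.degree u = 1)).card

/-- The unnormalized weight `d(u) + a` with which the vertex `u` is chosen. -/
noncomputable def weight (a : ℝ) (G : MGraph) (u : ℕ) : ENNReal :=
  if u < G.numV then ENNReal.ofReal ((G.degree u : ℝ) + a) else 0

open Classical in
/-- A random vertex of `G`, chosen with probability proportional to `d(u) + a`.
(For `a > -1` and a graph with at least one vertex and all degrees at least one, the total weight
is positive and finite; the `else` branch only makes the definition total.) -/
noncomputable def pick (a : ℝ) (G : MGraph) : PMF ℕ :=
  if h : (∑' u, weight a G u) ≠ 0 ∧ (∑' u, weight a G u) ≠ ⊤ then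
    PMF.normalize (weight a G) h.1 h.2
  else PMF.pure 0

/-- Add a new vertex (it gets the label `numV`) and an edge from it to `u`. -/
def MGraph.addVertex (G : MGraph) (u : ℕ) : MGraph :=
  ⟨G.numV + 1, s(u, G.numV) ::ₘ G.edges⟩

/-- Add an edge (a loop if `u = w`) between the existing vertices `u` and `w`. -/
def MGraph.addEdge (G : MGraph) (u w : ℕ) : MGraph :=
  ⟨G.numV, s(u, w) ::ₘ G.edges⟩

/-- One step of the evolution with parameter `a`: a vertex-step if `vs = true`,
an edge-step (two independent choices) if `vs = false`. -/
noncomputable def step (a : ℝ) (vs : Bool) (G : MGraph) : PMF MGraph :=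
  if vs then (pick a G).map G.addVertex
  else (pick a G).bind fun u => (pick a G).map fun w => G.addEdge u w

/-- The sample space: trajectories `G_0, G_1, G_2, …` of graphs. -/
def GraphPath : Type := ℕ → MGraph

/-- Every set of trajectories is an event (the laws below have finite support). -/
instance : MeasurableSpace GraphPath := ⊤

/-- The law of the trajectory `G_0, …, G_n` (constant after time `n`): the graph `G_0` is the
initial one, and `G_t` is formed from `G_{t-1}` by one step with parameter `a t` and type `vs t`. -/
noncomputable def pathPMF (vs : ℕ → Bool) (a : ℕ → ℝ) : ℕ → PMF GraphPath
  | 0 => PMF.pure fun _ => MGraph.init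
  | n + 1 => (pathPMF vs a n).bind fun ω =>
      (step (a (n + 1)) (vs (n + 1)) (ω n)).map fun G =>
        (fun t => if t ≤ n then ω t else G : GraphPath)

/-- The probability measure of the graph process up to the time horizon `n`. -/
noncomputable def law (vs : ℕ → Bool) (a : ℕ → ℝ) (n : ℕ) : Measure GraphPath :=
  (pathPMF vs a n).toMeasure

/-- `x_t`, the number of leaves of `G_t`. -/
def x (t : ℕ) (ω : GraphPath) : ℕ := (ω t).numLeaves

/-- `Γ_t`, the σ-field generated by `x_0, …, x_t`. -/
@[reducible] def Γ (t : ℕ) : MeasurableSpace GraphPath :=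
  ⨆ s ∈ Finset.range (t + 1), MeasurableSpace.comap (x s) ⊤

/-- `y_t = v_t - v_{t-1}`: one in a vertex-step, zero in an edge-step. -/
def y (vs : ℕ → Bool) (t : ℕ) : ℕ := if vs t then 1 else 0

/-- `v_t`, the number of vertices of `G_t`. -/
def v (vs : ℕ → Bool) (t : ℕ) : ℕ := 1 + ∑ i ∈ Finset.range t, y vs (i + 1)

/-- The conditional expectation `E(x_t | Γ_S)` in the model with parameters `a`
(observed up to the horizon `n`). -/
noncomputable def condMean (vs : ℕ → Bool) (a : ℕ → ℝ) (n S t : ℕ) (ω : GraphPath) : ℝ :=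
  ((law vs a n)[fun ω' => (x t ω' : ℝ) | Γ S]) ω

/-- The parameter sequence `a`, replaced by the constant `b` on `[t₀, t₁]`. -/
noncomputable def constOn (a : ℕ → ℝ) (t₀ t₁ : ℕ) (b : ℝ) (t : ℕ) : ℝ :=
  if t₀ ≤ t ∧ t ≤ t₁ then b else a t

/-- `f_{S,t}(b)`: the conditional expectation `E(x_t | Γ_S)` in the model in which the parameter
is equal to `b` at all times in `[S, t]`. -/
noncomputable def f (vs : ℕ → Bool) (a : ℕ → ℝ) (n S t : ℕ) (b : ℝ) (ω : GraphPath) : ℝ :=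
  condMean vs (constOn a S t b) n S t ω

/-- `b` is a least-squares estimate of the parameter on `[S, T]`:
a minimizer of `(f_{S,T}(b) - x_T)²` over the parameter space `(-1, ∞)`. -/
def IsArgminLoss (vs : ℕ → Bool) (a : ℕ → ℝ) (S T : ℕ) (ω : GraphPath) (b : ℝ) : Prop :=
  b ∈ Set.Ioi (-1 : ℝ) ∧
    IsMinOn (fun b' => (f vs a T S T b' ω - (x T ω : ℝ)) ^ 2) (Set.Ioi (-1 : ℝ)) b

/-- `m_t` for the constant parameter `b`: `(1 + b) / (2 t - 1 + b v_{t-1})` (used for `t ≥ 1`). -/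
noncomputable def m (vs : ℕ → Bool) (b : ℝ) (t : ℕ) : ℝ :=
  (1 + b) / (2 * (t : ℝ) - 1 + b * (v vs (t - 1) : ℝ))

/-- The fitted number of leaves `x̂_t`, `t ≥ S`, for the estimate `b`:
`x̂_S = x_S` and `x̂_t = (1 - m̂_t) (1 - (1 - y_t) m̂_t) x̂_{t-1} + y_t` for `t > S`. -/
noncomputable def xhat (vs : ℕ → Bool) (b : ℝ) (S : ℕ) (ω : GraphPath) : ℕ → ℝ
  | 0 => (x S ω : ℝ)
  | t + 1 =>
      if t + 1 ≤ S then (x S ω : ℝ)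
      else (1 - m vs b (t + 1)) * (1 - (1 - (y vs (t + 1) : ℝ)) * m vs b (t + 1)) *
        xhat vs b S ω t + (y vs (t + 1) : ℝ)

/-- `h(t) = |E(x_t | Γ_S) - f_{S,t}(b)|`, at the horizon `T`. -/
noncomputable def h (vs : ℕ → Bool) (a : ℕ → ℝ) (S T : ℕ) (b : ℝ) (ω : GraphPath) (t : ℕ) : ℝ :=
  |condMean vs a T S t ω - f vs a T S t b ω|

/-- `k` maximizes `g` over the integers of the open interval `(S, T)`. -/
def IsArgmax (g : ℕ → ℝ) (S T k : ℕ) : Prop :=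
  k ∈ Set.Ioo S T ∧ IsMaxOn g (Set.Ioo S T) k

/-- `X_T = O_p(r_T)` as `T → ∞`, where `X_T` is a random variable under `μ_T`. -/
def IsBigOp {Ω : Type*} [MeasurableSpace Ω] (μ : ℕ → Measure Ω) (X : ℕ → Ω → ℝ) (r : ℕ → ℝ) :
    Prop :=
  ∀ ε : ℝ, 0 < ε → ∃ M : ℝ, 0 < M ∧
    ∀ᶠ T in atTop, μ T {ω | M * r T < |X T ω|} ≤ ENNReal.ofReal ε

end PrefAttach

/-! All leaves have the same weight, so each is hit with the same probability and the mean leaf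
count after one step is an affine function of the current leaf count, whatever the rest of the graph
(`Reachable.expect_numLeaves`). Iterating, E(x_t | Γ_S) is the solution `leafMean` of a linear
recursion started at x_S (`condMean_eq_leafMean`), and the same recursion with constant parameter b
identifies f_{S,t}(b) with `xhat` (`f_eq_xhat`).

Hence the fitting error |x̂_t - x_t| and h(t) differ by at most |x_t - E(x_t | Γ_S)|. The estimate â
cancels in this comparison, so its dependence on the data is harmless.

The remaining deviation is a sum of martingale differences of bounded range, damped by factors in
[0, 1]. An Azuma-Hoeffding argument (`expect_exp_le`, `law_deviation_le`) and a union bound give at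
most D = 2 √T log T uniformly in t, up to probability O(1/T) (`law_exists_deviation_le`). Linear
separation of h from its maximum then forces any maximizer k of the fitting error to satisfy c |k -
R̂| ≤ 2D (`mul_abs_sub_le_of_isArgmax`). -/

namespace PrefAttach

open scoped ENNReal

/-! ### Expectations under probability mass functions -/

section Expect

variable {α β : Type*}

/-- The expectation of a `[0, ∞]`-valued function under a probability mass function. -/
noncomputable def expect (p : PMF α) (F : α → ℝ≥0∞) : ℝ≥0∞ := ∑' a, p a * F a

theorem expect_congr {p : PMF α} {F F' : α → ℝ≥0∞} (hF : ∀ a ∈ p.support, F a = F' a) :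
    expect p F = expect p F' := by
  refine tsum_congr fun a => ?_
  by_cases ha : p a = 0
  · simp [ha]
  · rw [hF a ha]

theorem expect_mono {p : PMF α} {F F' : α → ℝ≥0∞} (hF : ∀ a ∈ p.support, F a ≤ F' a) :
    expect p F ≤ expect p F' := by
  refine ENNReal.tsum_le_tsum fun a => ?_
  by_cases ha : p a = 0
  · simp [ha]
  · gcongr
    exact hF a ha

theorem expect_pure (a : α) (F : α → ℝ≥0∞) : expect (PMF.pure a) F = F a := by
  classical
  rw [expect, tsum_eq_single a]
  · simp
  · intro b hb
    simp [hb]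

theorem expect_bind (p : PMF α) (q : α → PMF β) (F : β → ℝ≥0∞) :
    expect (p.bind q) F = expect p fun a => expect (q a) F := by
  simp only [expect, PMF.bind_apply, ← ENNReal.tsum_mul_left, ← ENNReal.tsum_mul_right]
  rw [ENNReal.tsum_comm]
  simp only [mul_assoc]

theorem expect_map (p : PMF α) (g : α → β) (F : β → ℝ≥0∞) :
    expect (p.map g) F = expect p fun a => F (g a) := by
  simp only [PMF.map, expect_bind, Function.comp, expect_pure]

theorem expect_const (p : PMF α) (c : ℝ≥0∞) : expect p (fun _ => c) = c := by
  rw [expect, ENNReal.tsum_mul_right, p.tsum_coe, one_mul]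

theorem expect_add (p : PMF α) (F F' : α → ℝ≥0∞) :
    expect p (fun a => F a + F' a) = expect p F + expect p F' := by
  simp only [expect, mul_add, ENNReal.tsum_add]

theorem expect_mul_left (p : PMF α) (c : ℝ≥0∞) (F : α → ℝ≥0∞) :
    expect p (fun a => c * F a) = c * expect p F := by
  simp only [expect, ← ENNReal.tsum_mul_left, mul_left_comm]

theorem expect_finset_sum {ι : Type*} (p : PMF α) (s : Finset ι) (F : ι → α → ℝ≥0∞) :
    expect p (fun a => ∑ i ∈ s, F i a) = ∑ i ∈ s, expect p (F i) := by
  simp only [expect, Finset.mul_sum]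
  exact Summable.tsum_finsetSum fun i _ => ENNReal.summable

theorem expect_ne (p : PMF ℕ) (z : ℕ) :
    expect p (fun u => if z ≠ u then 1 else 0) = 1 - p z := by
  have h1 : expect p (fun u => if z ≠ u then 1 else 0) +
      expect p (fun u => if z = u then 1 else 0) = 1 := by
    rw [← expect_add]
    refine (expect_congr fun u _ => ?_).trans (expect_const p 1)
    by_cases hzu : z = u <;> simp [hzu]
  have h2 : expect p (fun u => if z = u then 1 else 0) = p z := by
    rw [expect, tsum_eq_single z]
    · simp
    · intro u hu
      simp [hu.symm]
  rw [h2] at h1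
  exact ENNReal.eq_sub_of_add_eq (p.apply_ne_top z) h1

/-- The measure is a weighted sum of Dirac masses. Measurability of every set replaces countability
of the space, which fails for trajectories. -/
theorem lintegral_toMeasure_eq_expect [MeasurableSpace α] (htop : ∀ s : Set α, MeasurableSet s)
    (p : PMF α) (F : α → ℝ≥0∞) : ∫⁻ a, F a ∂p.toMeasure = expect p F := by
  have hp : p.toMeasure = Measure.sum fun a => p a • Measure.dirac a := by
    ext s hs
    rw [Measure.sum_apply _ hs, p.toMeasure_apply hs]
    refine tsum_congr fun a => ?_
    by_cases ha : a ∈ s <;> simp [ha, Measure.dirac_apply' _ hs]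
  rw [hp, lintegral_sum_measure, expect]
  refine tsum_congr fun a => ?_
  rw [lintegral_smul_measure, lintegral_dirac' _ (fun t _ => htop _), smul_eq_mul]

end Expect

/-! ### Degrees, leaves and the law of a single pick -/

section Graph

/-- For a loop both indicators fire, in agreement with the extra `count` term in the degree. -/
theorem MGraph.degree_addEdge (G : MGraph) (u w z : ℕ) :
    (G.addEdge u w).degree z =
      G.degree z + (if z = u then 1 else 0) + (if z = w then 1 else 0) := by
  simp only [MGraph.degree, MGraph.addEdge, Multiset.countP_cons, Multiset.count_cons, Sym2.mem_iff,
    Sym2.eq_iff]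
  grind

theorem MGraph.degree_addVertex (G : MGraph) (u z : ℕ) :
    (G.addVertex u).degree z =
      G.degree z + (if z = u then 1 else 0) + (if z = G.numV then 1 else 0) :=
  G.degree_addEdge u G.numV z

theorem MGraph.numLeaves_eq_sum (G : MGraph) :
    G.numLeaves = ∑ z ∈ Finset.range G.numV, if G.degree z = 1 then 1 else 0 := by
  rw [MGraph.numLeaves, Finset.card_filter]

/-- The leaves of a graph. -/
def MGraph.leaves (G : MGraph) : Finset ℕ :=
  (Finset.range G.numV).filter fun u => G.degree u = 1

theorem v_succ (vs : ℕ → Bool) (t : ℕ) : v vs (t + 1) = v vs t + y vs (t + 1) := by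
  simp [v, Finset.sum_range_succ, add_assoc]

theorem y_le_one (vs : ℕ → Bool) (t : ℕ) : y vs t ≤ 1 := by
  unfold y; split <;> simp

theorem one_le_v (vs : ℕ → Bool) (t : ℕ) : 1 ≤ v vs t := by simp [v]

theorem v_le (vs : ℕ → Bool) (t : ℕ) : v vs t ≤ t + 1 := by
  induction t with
  | zero => simp [v]
  | succ t ih => have := y_le_one vs (t + 1); rw [v_succ]; omega

/-- The properties shared by all possible graphs at time `t`. -/
structure Reachable (vs : ℕ → Bool) (t : ℕ) (G : MGraph) : Prop where
  numV_eq : G.numV = v vs t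
  lt_numV : ∀ e ∈ G.edges, ∀ u ∈ e, u < G.numV
  one_le_degree : ∀ u < G.numV, 1 ≤ G.degree u
  sum_degree : ∑ u ∈ Finset.range G.numV, G.degree u = 2 * t + 1

theorem reachable_init (vs : ℕ → Bool) : Reachable vs 0 MGraph.init where
  numV_eq := by simp [MGraph.init, v]
  lt_numV := by simp [MGraph.init]
  one_le_degree := by simp [MGraph.init, MGraph.degree]
  sum_degree := by simp [MGraph.init, MGraph.degree]

namespace Reachable

variable {vs : ℕ → Bool} {t : ℕ} {G : MGraph}

theorem numV_pos (hG : Reachable vs t G) : 0 < G.numV := by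
  rw [hG.numV_eq]; exact one_le_v vs t

theorem degree_numV (hG : Reachable vs t G) : G.degree G.numV = 0 := by
  have h1 : G.edges.countP (fun e => G.numV ∈ e) = 0 :=
    Multiset.countP_eq_zero.2 fun e he hm => lt_irrefl _ (hG.lt_numV e he _ hm)
  have h2 : G.edges.count s(G.numV, G.numV) = 0 :=
    Multiset.count_eq_zero.2 fun he => lt_irrefl _ (hG.lt_numV _ he G.numV (by simp))
  have := hG.numV_pos
  simp only [MGraph.degree, h1, h2]
  rw [if_neg (by omega)]

theorem addEdge (hG : Reachable vs t G) (ht : vs (t + 1) = false) {u w : ℕ} (hu : u < G.numV)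
    (hw : w < G.numV) : Reachable vs (t + 1) (G.addEdge u w) where
  numV_eq := by rw [v_succ, ← hG.numV_eq]; simp [y, ht, MGraph.addEdge]
  lt_numV := by
    intro e he z hz
    rcases Multiset.mem_cons.1 he with rfl | he
    · rcases Sym2.mem_iff.1 hz with rfl | rfl <;> assumption
    · exact hG.lt_numV e he z hz
  one_le_degree := by
    intro z hz
    have := hG.one_le_degree z hz
    rw [MGraph.degree_addEdge]
    omega
  sum_degree := by
    have h1 := hG.sum_degree
    simp only [MGraph.degree_addEdge]
    change ∑ z ∈ Finset.range G.numV, _ = _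
    simp only [Finset.sum_add_distrib, h1, Finset.sum_ite_eq', Finset.mem_range, hu, hw, if_true]
    ring

theorem addVertex (hG : Reachable vs t G) (ht : vs (t + 1) = true) {u : ℕ} (hu : u < G.numV) :
    Reachable vs (t + 1) (G.addVertex u) where
  numV_eq := by rw [v_succ, ← hG.numV_eq]; simp [y, ht, MGraph.addVertex]
  lt_numV := by
    intro e he z hz
    change z < G.numV + 1
    rcases Multiset.mem_cons.1 he with rfl | he
    · rcases Sym2.mem_iff.1 hz with rfl | rfl <;> omega
    · exact (hG.lt_numV e he z hz).trans (Nat.lt_succ_self _)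
  one_le_degree := by
    intro z hz
    rw [MGraph.degree_addVertex]
    rcases (Nat.lt_succ_iff_lt_or_eq.1 hz) with hz | rfl
    · have := hG.one_le_degree z hz
      omega
    · simp
  sum_degree := by
    have h1 := hG.sum_degree
    simp only [MGraph.degree_addVertex]
    change ∑ z ∈ Finset.range (G.numV + 1), _ = _
    rw [Finset.sum_range_succ, hG.degree_numV]
    simp only [Finset.sum_add_distrib, h1, Finset.sum_ite_eq', Finset.mem_range, hu, lt_irrefl,
      if_true, if_false, hu.ne']
    ring

/-- Degrees are at least one and never decrease, so the leaves afterwards are the old leaves that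
were not picked. The product form lets the two independent picks factor. -/
theorem numLeaves_addEdge (hG : Reachable vs t G) (u w : ℕ) :
    (G.addEdge u w).numLeaves =
      ∑ z ∈ G.leaves, (if z ≠ u then 1 else 0) * (if z ≠ w then 1 else 0) := by
  rw [MGraph.numLeaves_eq_sum, MGraph.leaves, Finset.sum_filter]
  refine Finset.sum_congr rfl fun z hz => ?_
  have := hG.one_le_degree z (Finset.mem_range.1 hz)
  rw [MGraph.degree_addEdge]
  grind

theorem numLeaves_addVertex (hG : Reachable vs t G) {u : ℕ} (hu : u < G.numV) :
    (G.addVertex u).numLeaves = (∑ z ∈ G.leaves, if z ≠ u then 1 else 0) + 1 := by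
  rw [MGraph.numLeaves_eq_sum, MGraph.leaves, Finset.sum_filter]
  change ∑ z ∈ Finset.range (G.numV + 1), _ = _
  rw [Finset.sum_range_succ]
  congr 1
  · refine Finset.sum_congr rfl fun z hz => ?_
    have := hG.one_le_degree z (Finset.mem_range.1 hz)
    have := Finset.mem_range.1 hz
    rw [MGraph.degree_addVertex]
    grind
  · rw [MGraph.degree_addVertex, hG.degree_numV]
    simp [hu.ne']

theorem card_leaves_le_numLeaves_addEdge (hG : Reachable vs t G) (u w : ℕ) :
    G.numLeaves ≤ (G.addEdge u w).numLeaves + 2 := by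
  have h1 : G.leaves ⊆ (G.leaves.filter fun z => z ≠ u ∧ z ≠ w) ∪ {u, w} := by
    intro z hz
    simp only [Finset.mem_union, Finset.mem_filter, Finset.mem_insert, Finset.mem_singleton, hz,
      true_and]
    tauto
  have h2 := (Finset.card_le_card h1).trans (Finset.card_union_le _ _)
  have h3 : (({u, w} : Finset ℕ)).card ≤ 2 := Finset.card_le_two
  have h4 : (G.addEdge u w).numLeaves = (G.leaves.filter fun z => z ≠ u ∧ z ≠ w).card := by
    rw [hG.numLeaves_addEdge, Finset.card_filter]
    refine Finset.sum_congr rfl fun z _ => ?_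
    grind
  have h5 : G.numLeaves = G.leaves.card := rfl
  omega

theorem numLeaves_addEdge_le (hG : Reachable vs t G) (u w : ℕ) :
    (G.addEdge u w).numLeaves ≤ G.numLeaves := by
  rw [hG.numLeaves_addEdge, show G.numLeaves = G.leaves.card from rfl, Finset.card_eq_sum_ones]
  refine Finset.sum_le_sum fun z _ => ?_
  grind

theorem numLeaves_addVertex_eq (hG : Reachable vs t G) {u : ℕ} (hu : u < G.numV) :
    (G.addVertex u).numLeaves = (G.addEdge u u).numLeaves + 1 := by
  rw [hG.numLeaves_addVertex hu, hG.numLeaves_addEdge]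
  congr 1
  refine Finset.sum_congr rfl fun z _ => ?_
  grind

theorem tsum_weight (hG : Reachable vs t G) {a : ℝ} (ha : -1 < a) :
    ∑' u, weight a G u = ENNReal.ofReal (2 * t + 1 + a * v vs t) := by
  rw [tsum_eq_sum (s := Finset.range G.numV) (fun u hu => by
    simp only [Finset.mem_range] at hu; simp [weight, hu])]
  rw [Finset.sum_congr rfl (fun u hu => by
    rw [weight, if_pos (Finset.mem_range.1 hu)])]
  rw [← ENNReal.ofReal_sum_of_nonneg]
  · have := hG.sum_degree
    rw [Finset.sum_add_distrib, ← Nat.cast_sum, this]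
    simp [← hG.numV_eq, mul_comm]
  · intro u hu
    have : (1 : ℝ) ≤ G.degree u := by
      exact_mod_cast hG.one_le_degree u (Finset.mem_range.1 hu)
    linarith

end Reachable

/-- The difference is 2t + a (v_t - 1), which is nonnegative because 0 ≤ v_t - 1 ≤ t and a > -1.
This gives both a positive total weight and `m ≤ 1`. -/
theorem one_add_le_total (vs : ℕ → Bool) (t : ℕ) {a : ℝ} (ha : -1 < a) :
    1 + a ≤ 2 * t + 1 + a * v vs t := by
  have h1 : (1 : ℝ) ≤ v vs t := by exact_mod_cast one_le_v vs t
  have h2 : (v vs t : ℝ) ≤ t + 1 := by exact_mod_cast v_le vs t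
  nlinarith

theorem m_succ (vs : ℕ → Bool) (a : ℝ) (t : ℕ) :
    m vs a (t + 1) = (1 + a) / (2 * t + 1 + a * v vs t) := by
  simp only [m, Nat.add_sub_cancel]
  push_cast
  ring_nf

theorem m_succ_nonneg (vs : ℕ → Bool) (t : ℕ) {a : ℝ} (ha : -1 < a) : 0 ≤ m vs a (t + 1) := by
  have := one_add_le_total vs t ha
  rw [m_succ]
  apply div_nonneg <;> linarith

theorem m_succ_le_one (vs : ℕ → Bool) (t : ℕ) {a : ℝ} (ha : -1 < a) : m vs a (t + 1) ≤ 1 := by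
  have := one_add_le_total vs t ha
  rw [m_succ]
  apply div_le_one_of_le₀ <;> linarith

namespace Reachable

variable {vs : ℕ → Bool} {t : ℕ} {G : MGraph}

theorem pick_apply (hG : Reachable vs t G) {a : ℝ} (ha : -1 < a) (u : ℕ) :
    pick a G u = weight a G u * (ENNReal.ofReal (2 * t + 1 + a * v vs t))⁻¹ := by
  have h1 := one_add_le_total vs t ha
  have h2 : (∑' u, weight a G u) ≠ 0 ∧ (∑' u, weight a G u) ≠ ⊤ := by
    rw [hG.tsum_weight ha]
    exact ⟨(ENNReal.ofReal_pos.2 (by linarith)).ne', ENNReal.ofReal_ne_top⟩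
  rw [pick, dif_pos h2, PMF.normalize_apply, hG.tsum_weight ha]

theorem mem_support_pick (hG : Reachable vs t G) {a : ℝ} (ha : -1 < a) (u : ℕ) :
    u ∈ (pick a G).support ↔ u < G.numV := by
  rw [PMF.mem_support_iff, hG.pick_apply ha, weight]
  by_cases hu : u < G.numV
  · have : (1 : ℝ) ≤ G.degree u := by exact_mod_cast hG.one_le_degree u hu
    have h2 : ENNReal.ofReal ((G.degree u : ℝ) + a) ≠ 0 :=
      (ENNReal.ofReal_pos.2 (by linarith)).ne'
    simp only [hu, if_true, iff_true]
    exact mul_ne_zero h2 (ENNReal.inv_ne_zero.2 ENNReal.ofReal_ne_top)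
  · simp [hu]

/-- A leaf has weight 1 + a out of the total 2t + 1 + a v_t, so `m` at time t + 1 is exactly the
probability of picking it. -/
theorem expect_pick_ne (hG : Reachable vs t G) {a : ℝ} (ha : -1 < a) {z : ℕ} (hz : z ∈ G.leaves) :
    expect (pick a G) (fun u => if z ≠ u then 1 else 0) =
      ENNReal.ofReal (1 - m vs a (t + 1)) := by
  have h1 := one_add_le_total vs t ha
  simp only [MGraph.leaves, Finset.mem_filter, Finset.mem_range] at hz
  rw [expect_ne, hG.pick_apply ha, weight, if_pos hz.1, hz.2,
    ENNReal.ofReal_sub _ (m_succ_nonneg vs t ha), ENNReal.ofReal_one, m_succ,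
    ENNReal.ofReal_div_of_pos (by linarith), ENNReal.div_eq_inv_mul, mul_comm]
  simp

theorem mem_support_step (hG : Reachable vs t G) {a : ℝ} (ha : -1 < a) (b : Bool) (G' : MGraph) :
    G' ∈ (step a b G).support ↔
      (b = true ∧ ∃ u < G.numV, G' = G.addVertex u) ∨
      (b = false ∧ ∃ u < G.numV, ∃ w < G.numV, G' = G.addEdge u w) := by
  cases b <;>
    simp [step, hG.mem_support_pick ha, eq_comm,
      -PMF.mem_support_iff]

theorem of_mem_support_step (hG : Reachable vs t G) {a : ℝ} (ha : -1 < a) {G' : MGraph}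
    (h : G' ∈ (step a (vs (t + 1)) G).support) : Reachable vs (t + 1) G' := by
  rcases (hG.mem_support_step ha _ _).1 h with ⟨ht, u, hu, rfl⟩ | ⟨ht, u, hu, w, hw, rfl⟩
  · exact hG.addVertex ht hu
  · exact hG.addEdge ht hu hw

/-- The range has length 3; this is the input to Hoeffding's lemma. -/
theorem numLeaves_mem_Icc (hG : Reachable vs t G) {a : ℝ} (ha : -1 < a) {G' : MGraph} {b : Bool}
    (h : G' ∈ (step a b G).support) :
    (G'.numLeaves : ℝ) ∈ Set.Icc ((G.numLeaves : ℝ) - 2) (G.numLeaves + 1) := by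
  suffices G.numLeaves ≤ G'.numLeaves + 2 ∧ G'.numLeaves ≤ G.numLeaves + 1 by
    refine ⟨?_, by exact_mod_cast this.2⟩
    have : (G.numLeaves : ℝ) ≤ G'.numLeaves + 2 := by exact_mod_cast this.1
    linarith
  rcases (hG.mem_support_step ha _ _).1 h with ⟨-, u, hu, rfl⟩ | ⟨-, u, hu, w, hw, rfl⟩
  · rw [hG.numLeaves_addVertex_eq hu]
    have h1 := hG.card_leaves_le_numLeaves_addEdge u u
    have h2 := hG.numLeaves_addEdge_le u u
    omega
  · have h1 := hG.card_leaves_le_numLeaves_addEdge u w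
    have h2 := hG.numLeaves_addEdge_le u w
    omega

end Reachable

/-! ### One-step mean of the leaf count -/

/-- The factor by which the mean number of leaves is multiplied in step `t`. -/
noncomputable def decay (vs : ℕ → Bool) (a : ℝ) (t : ℕ) : ℝ :=
  (1 - m vs a t) * (1 - (1 - (y vs t : ℝ)) * m vs a t)

theorem decay_succ_nonneg (vs : ℕ → Bool) (t : ℕ) {a : ℝ} (ha : -1 < a) :
    0 ≤ decay vs a (t + 1) := by
  have h1 := m_succ_nonneg vs t ha
  have h2 := m_succ_le_one vs t ha
  unfold decay y
  split <;> simp <;> nlinarith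

theorem decay_succ_le_one (vs : ℕ → Bool) (t : ℕ) {a : ℝ} (ha : -1 < a) :
    decay vs a (t + 1) ≤ 1 := by
  have h1 := m_succ_nonneg vs t ha
  have h2 := m_succ_le_one vs t ha
  unfold decay y
  split <;> simp <;> nlinarith

/-- By linearity over the leaves: each survives a vertex-step with probability 1 - m and an
edge-step with probability (1 - m)², and a vertex-step creates one new leaf. -/
theorem Reachable.expect_numLeaves {vs : ℕ → Bool} {t : ℕ} {G : MGraph} (hG : Reachable vs t G)
    {a : ℝ} (ha : -1 < a) :
    expect (step a (vs (t + 1)) G) (fun G' => (G'.numLeaves : ℝ≥0∞)) =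
      ENNReal.ofReal (decay vs a (t + 1) * G.numLeaves + y vs (t + 1)) := by
  have hm := m_succ_le_one vs t ha
  have hcard : (G.leaves.card : ℝ≥0∞) = ENNReal.ofReal (G.numLeaves : ℝ) := by
    rw [ENNReal.ofReal_natCast]; rfl
  cases ht : vs (t + 1) with
  | true =>
    simp only [step, if_true, expect_map]
    rw [expect_congr (F' := fun u => (∑ z ∈ G.leaves, if z ≠ u then 1 else 0) + 1)
      (fun u hu => by
        rw [hG.numLeaves_addVertex ((hG.mem_support_pick ha u).1 hu)]; push_cast; rfl)]
    rw [expect_add, expect_const, expect_finset_sum,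
      Finset.sum_congr rfl (fun z hz => hG.expect_pick_ne ha hz), Finset.sum_const, nsmul_eq_mul,
      hcard, ← ENNReal.ofReal_mul (by positivity), ← ENNReal.ofReal_one,
      ← ENNReal.ofReal_add (mul_nonneg (by positivity) (by linarith)) (by norm_num)]
    simp [decay, y, ht, mul_comm]
  | false =>
    simp only [step, Bool.false_eq_true, if_false, expect_map, expect_bind]
    have h1 : ∀ u w, ((G.addEdge u w).numLeaves : ℝ≥0∞) =
        ∑ z ∈ G.leaves, (if z ≠ u then 1 else 0) * (if z ≠ w then 1 else 0) := by
      intro u w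
      rw [hG.numLeaves_addEdge]
      push_cast
      rfl
    simp only [h1, expect_finset_sum, expect_mul_left]
    rw [Finset.sum_congr rfl (g := fun _ => ENNReal.ofReal ((1 - m vs a (t + 1)) ^ 2))
      (fun z hz => by
        rw [hG.expect_pick_ne ha hz]
        simp only [mul_comm _ (ENNReal.ofReal _), expect_mul_left]
        rw [hG.expect_pick_ne ha hz, ← ENNReal.ofReal_mul (by linarith), sq]),
      Finset.sum_const, nsmul_eq_mul, hcard, ← ENNReal.ofReal_mul (by positivity)]
    congr 1
    simp only [decay, y, ht, Bool.false_eq_true, if_false]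
    push_cast
    ring

end Graph

end PrefAttach

/-! ### Trajectories and the Markov property -/

namespace PrefAttach

open scoped ENNReal

theorem ae_toMeasure_iff {α : Type*} [MeasurableSpace α] (htop : ∀ s : Set α, MeasurableSet s)
    (p : PMF α) (Q : α → Prop) : (∀ᵐ a ∂p.toMeasure, Q a) ↔ ∀ a ∈ p.support, Q a := by
  rw [ae_iff, p.toMeasure_apply_eq_zero_iff (htop _), Set.disjoint_left]
  simp

theorem measurableSet_graphPath (s : Set GraphPath) : MeasurableSet s :=
  MeasurableSpace.measurableSet_top

section Path

variable {vs : ℕ → Bool} {a : ℕ → ℝ}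

/-- The trajectory `ω` up to time `n`, followed by the constant graph `G`. -/
def GraphPath.extend (n : ℕ) (ω : GraphPath) (G : MGraph) : GraphPath :=
  fun t => if t ≤ n then ω t else G

theorem GraphPath.extend_of_le {n t : ℕ} (h : t ≤ n) (ω : GraphPath) (G : MGraph) :
    GraphPath.extend n ω G t = ω t := if_pos h

theorem GraphPath.extend_of_lt {n t : ℕ} (h : n < t) (ω : GraphPath) (G : MGraph) :
    GraphPath.extend n ω G t = G := if_neg (by omega)

theorem pathPMF_succ (n : ℕ) :
    pathPMF vs a (n + 1) = (pathPMF vs a n).bind fun ω =>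
      (step (a (n + 1)) (vs (n + 1)) (ω n)).map (GraphPath.extend n ω) := rfl

theorem expect_pathPMF_succ (n : ℕ) (F : GraphPath → ℝ≥0∞) :
    expect (pathPMF vs a (n + 1)) F = expect (pathPMF vs a n) fun ω =>
      expect (step (a (n + 1)) (vs (n + 1)) (ω n)) fun G =>
        F (GraphPath.extend n ω G) := by
  simp only [pathPMF_succ, expect_bind, expect_map]

theorem mem_support_pathPMF_succ (n : ℕ) (ω : GraphPath) :
    ω ∈ (pathPMF vs a (n + 1)).support ↔ ∃ ω' ∈ (pathPMF vs a n).support,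
      ∃ G ∈ (step (a (n + 1)) (vs (n + 1)) (ω' n)).support,
        GraphPath.extend n ω' G = ω := by
  simp only [pathPMF_succ, PMF.mem_support_bind_iff, PMF.mem_support_map_iff]

theorem reachable_of_mem_support (ha : ∀ t, -1 < a t) {n : ℕ} {ω : GraphPath}
    (hω : ω ∈ (pathPMF vs a n).support) {t : ℕ} (ht : t ≤ n) : Reachable vs t (ω t) := by
  induction n generalizing ω t with
  | zero =>
    obtain rfl : t = 0 := by omega
    have h0 : ω = fun _ => MGraph.init := (PMF.mem_support_pure_iff _ _).1 hω
    have h1 : ω 0 = MGraph.init := congrFun h0 0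
    rw [h1]
    exact reachable_init vs
  | succ n ih =>
    obtain ⟨ω', hω', G, hG, rfl⟩ := (mem_support_pathPMF_succ n ω).1 hω
    rcases Nat.lt_or_ge n t with htn | htn
    · obtain rfl : t = n + 1 := by omega
      rw [GraphPath.extend_of_lt htn]
      exact (ih hω' le_rfl).of_mem_support_step (ha _) hG
    · rw [GraphPath.extend_of_le htn]
      exact ih hω' htn

/-- The possible trajectories do not depend on the parameters. -/
theorem mem_support_pathPMF_of_mem {a' : ℕ → ℝ} (ha : ∀ t, -1 < a t) (ha' : ∀ t, -1 < a' t)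
    {n : ℕ} {ω : GraphPath} (hω : ω ∈ (pathPMF vs a n).support) :
    ω ∈ (pathPMF vs a' n).support := by
  induction n generalizing ω with
  | zero => exact hω
  | succ n ih =>
    obtain ⟨ω', hω', G, hG, rfl⟩ := (mem_support_pathPMF_succ n ω).1 hω
    have hr := reachable_of_mem_support ha hω' le_rfl
    exact (mem_support_pathPMF_succ n _).2 ⟨ω', ih hω', G,
      (hr.mem_support_step (ha' _) _ _).2 ((hr.mem_support_step (ha _) _ _).1 hG), rfl⟩

/-- A function of the trajectory that depends only on its values up to time `t`. -/
def DependsUpTo {β : Type*} (t : ℕ) (F : GraphPath → β) : Prop :=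
  ∀ ω ω' : GraphPath, (∀ s ≤ t, ω s = ω' s) → F ω = F ω'

theorem DependsUpTo.mono {β : Type*} {s t : ℕ} {F : GraphPath → β} (hF : DependsUpTo s F)
    (hst : s ≤ t) : DependsUpTo t F :=
  fun ω ω' h => hF ω ω' fun r hr => h r (hr.trans hst)

theorem dependsUpTo_x (t : ℕ) : DependsUpTo t (x t) := by
  intro ω ω' h
  simp only [x, h t le_rfl]

theorem expect_pathPMF_of_le {t n : ℕ} (htn : t ≤ n) {F : GraphPath → ℝ≥0∞}
    (hF : DependsUpTo t F) : expect (pathPMF vs a n) F = expect (pathPMF vs a t) F := by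
  induction n, htn using Nat.le_induction with
  | base => rfl
  | succ n htn ih =>
    rw [← ih, expect_pathPMF_succ]
    refine expect_congr fun ω _ => ?_
    rw [← expect_const (step (a (n + 1)) (vs (n + 1)) (ω n)) (F ω)]
    refine expect_congr fun G _ => hF _ _ fun s hs => ?_
    rw [GraphPath.extend_of_le (hs.trans htn)]

/-- The Markov property in integrated form: the past is frozen while the last step is averaged. -/
theorem expect_pathPMF_mul (t : ℕ) {F : GraphPath → ℝ≥0∞} (hF : DependsUpTo t F)
    (φ : GraphPath → MGraph → ℝ≥0∞) (hφ : DependsUpTo t φ) :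
    expect (pathPMF vs a (t + 1)) (fun ω => F ω * φ ω (ω (t + 1))) =
      expect (pathPMF vs a t) fun ω =>
        F ω * expect (step (a (t + 1)) (vs (t + 1)) (ω t)) (φ ω) := by
  rw [expect_pathPMF_succ]
  refine expect_congr fun ω _ => ?_
  rw [← expect_mul_left]
  refine expect_congr fun G _ => ?_
  have h : ∀ s ≤ t, GraphPath.extend t ω G s = ω s := fun s hs =>
    GraphPath.extend_of_le hs ω G
  rw [hF _ _ h, hφ _ _ h, GraphPath.extend_of_lt (Nat.lt_succ_self t)]

end Path

/-! ### Conditional means as solutions of a linear recursion -/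

/-- The mean number of leaves at time `t`, given that there are `x₀` leaves at time `S`, in the
model with the parameters `b`. -/
noncomputable def leafMean (vs : ℕ → Bool) (b : ℕ → ℝ) (S : ℕ) (x₀ : ℝ) : ℕ → ℝ
  | 0 => x₀
  | t + 1 =>
      if t + 1 ≤ S then x₀
      else decay vs (b (t + 1)) (t + 1) * leafMean vs b S x₀ t + y vs (t + 1)

theorem leafMean_of_le (vs : ℕ → Bool) (b : ℕ → ℝ) {S t : ℕ} (x₀ : ℝ) (h : t ≤ S) :
    leafMean vs b S x₀ t = x₀ := by
  cases t with
  | zero => rfl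
  | succ t => rw [leafMean, if_pos h]

theorem leafMean_succ (vs : ℕ → Bool) (b : ℕ → ℝ) {S t : ℕ} (x₀ : ℝ) (h : S ≤ t) :
    leafMean vs b S x₀ (t + 1) =
      decay vs (b (t + 1)) (t + 1) * leafMean vs b S x₀ t + y vs (t + 1) := by
  rw [leafMean, if_neg (by omega)]

theorem leafMean_nonneg (vs : ℕ → Bool) {b : ℕ → ℝ} (hb : ∀ t, -1 < b t) (S : ℕ) {x₀ : ℝ}
    (hx : 0 ≤ x₀) (t : ℕ) : 0 ≤ leafMean vs b S x₀ t := by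
  induction t with
  | zero => exact hx
  | succ t ih =>
    rw [leafMean]
    split_ifs
    · exact hx
    · have := decay_succ_nonneg vs t (hb (t + 1))
      positivity

theorem leafMean_congr (vs : ℕ → Bool) {b b' : ℕ → ℝ} {S t : ℕ} (x₀ : ℝ)
    (h : ∀ s, S < s → s ≤ t → b s = b' s) : leafMean vs b S x₀ t = leafMean vs b' S x₀ t := by
  induction t with
  | zero => rfl
  | succ t ih =>
    simp only [leafMean]
    split_ifs with hS
    · rfl
    · rw [ih fun s h1 h2 => h s h1 (by omega), h (t + 1) (by omega) le_rfl]

theorem xhat_eq_leafMean (vs : ℕ → Bool) (b : ℝ) (S : ℕ) (ω : GraphPath) (t : ℕ) :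
    xhat vs b S ω t = leafMean vs (fun _ => b) S (x S ω) t := by
  induction t with
  | zero => rfl
  | succ t ih => simp only [xhat, leafMean, ih, decay]

section Mean

variable {vs : ℕ → Bool} {a : ℕ → ℝ}

theorem dependsUpTo_leafMean {β : Type*} {S t : ℕ} (hS : S ≤ t) (φ : ℝ → β) (r : ℕ) :
    DependsUpTo t fun ω => φ (leafMean vs a S (x S ω) r) := by
  intro ω ω' h
  simp only [((dependsUpTo_x S).mono hS) ω ω' h]

/-- With F the indicator of an event of `Γ S`, this is the defining identity of the conditional
expectation. The induction works because the one-step mean is affine in the leaf count. -/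
theorem expect_mul_x (ha : ∀ t, -1 < a t) {S t n : ℕ} (hSt : S ≤ t) (htn : t ≤ n)
    {F : GraphPath → ℝ≥0∞} (hF : DependsUpTo S F) :
    expect (pathPMF vs a n) (fun ω => F ω * ENNReal.ofReal (x t ω)) =
      expect (pathPMF vs a n) fun ω => F ω * ENNReal.ofReal (leafMean vs a S (x S ω) t) := by
  have hdep : ∀ r, DependsUpTo S fun ω =>
      F ω * ENNReal.ofReal (leafMean vs a S (x S ω) r) := by
    intro r ω ω' h
    have := dependsUpTo_leafMean (vs := vs) (a := a) le_rfl ENNReal.ofReal r ω ω' h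
    dsimp only at this ⊢
    rw [hF ω ω' h, this]
  have hdepx : DependsUpTo t fun ω => F ω * ENNReal.ofReal (x t ω) := by
    intro ω ω' h
    dsimp only
    rw [hF.mono hSt ω ω' h, dependsUpTo_x t ω ω' h]
  rw [expect_pathPMF_of_le htn hdepx, expect_pathPMF_of_le (hSt.trans htn) (hdep t)]
  clear htn hdepx
  induction t, hSt using Nat.le_induction with
  | base => simp only [leafMean_of_le vs a _ le_rfl]
  | succ t hSt ih =>
    have hA := decay_succ_nonneg vs t (ha (t + 1))
    have hsplit : ∀ (c : ℝ≥0∞) (r : ℝ), 0 ≤ r →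
        c * ENNReal.ofReal (decay vs (a (t + 1)) (t + 1) * r + y vs (t + 1)) =
        ENNReal.ofReal (decay vs (a (t + 1)) (t + 1)) * (c * ENNReal.ofReal r) +
          ENNReal.ofReal (y vs (t + 1)) * c := by
      intro c r hr
      rw [ENNReal.ofReal_add (by positivity) (by positivity), ENNReal.ofReal_mul hA]
      ring
    have h1 := expect_pathPMF_mul (vs := vs) (a := a) t (hF.mono hSt)
      (fun _ G => (G.numLeaves : ℝ≥0∞)) (fun _ _ _ => rfl)
    simp only [x, ENNReal.ofReal_natCast] at h1 ⊢
    rw [h1]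
    have h2 : expect (pathPMF vs a t) (fun ω =>
        F ω * expect (step (a (t + 1)) (vs (t + 1)) (ω t)) fun G => (G.numLeaves : ℝ≥0∞)) =
        expect (pathPMF vs a t) fun ω =>
          ENNReal.ofReal (decay vs (a (t + 1)) (t + 1)) * (F ω * ENNReal.ofReal (x t ω)) +
          ENNReal.ofReal (y vs (t + 1)) * F ω := by
      refine expect_congr fun ω hω => ?_
      rw [(reachable_of_mem_support ha hω le_rfl).expect_numLeaves (ha _),
        hsplit _ _ (by positivity)]
      rfl
    rw [h2, expect_add, expect_mul_left, expect_mul_left, ih, expect_pathPMF_of_le hSt hF,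
      ← expect_mul_left, ← expect_mul_left, ← expect_add]
    refine expect_congr fun ω _ => ?_
    have h3 := leafMean_nonneg vs ha S (Nat.cast_nonneg (x S ω)) t
    rw [← hsplit _ _ h3, ← leafMean_succ vs a _ hSt]
    rfl

theorem dependsUpTo_mem_of_measurableSet {S : ℕ} {s : Set GraphPath} (hs : MeasurableSet[Γ S] s) :
    DependsUpTo S fun ω => ω ∈ s := by
  -- Stopping at time S leaves x_0, …, x_S unchanged, so every event of `Γ S` is a preimage under
  -- this map.
  let r : GraphPath → GraphPath := fun ω t => ω (min t S)
  have hle : Γ S ≤ MeasurableSpace.comap r ⊤ := by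
    refine iSup₂_le fun t ht => ?_
    have hx : x t = x t ∘ r := by
      funext ω
      have : min t S = t := by simp at ht; omega
      change (ω t).numLeaves = (ω (min t S)).numLeaves
      rw [this]
    rw [hx, ← MeasurableSpace.comap_comp]
    exact MeasurableSpace.comap_mono le_top
  obtain ⟨u, -, rfl⟩ := hle s hs
  intro ω ω' h
  have : r ω = r ω' := funext fun t => h _ (min_le_right _ _)
  simp only [Set.mem_preimage, this]

theorem measurable_x_filtration (S : ℕ) : Measurable[Γ S] (x S) :=
  (comap_measurable (x S)).mono
    (le_iSup₂_of_le (f := fun s (_ : s ∈ Finset.range (S + 1)) => MeasurableSpace.comap (x s) ⊤)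
      S (by simp) le_rfl) le_rfl

instance isProbabilityMeasure_law (vs : ℕ → Bool) (a : ℕ → ℝ) (n : ℕ) :
    IsProbabilityMeasure (law vs a n) := by
  unfold law; infer_instance

/-- The candidate is `Γ S`-measurable and has the right integrals, so it is a version of the
conditional expectation. Almost sure equality is equality at every point of the support, since each
such point is an atom. -/
theorem condMean_eq_leafMean (ha : ∀ t, -1 < a t) {S t n : ℕ} (hSt : S ≤ t) (htn : t ≤ n)
    {ω : GraphPath} (hω : ω ∈ (pathPMF vs a n).support) :
    condMean vs a n S t ω = leafMean vs a S (x S ω) t := by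
  set μ := law vs a n with hμ
  have hlin : ∀ F : GraphPath → ℝ≥0∞, ∫⁻ ω, F ω ∂μ = expect (pathPMF vs a n) F := fun F =>
    lintegral_toMeasure_eq_expect measurableSet_graphPath _ F
  have hmeas : ∀ g : GraphPath → ℝ, AEStronglyMeasurable g μ := fun g =>
    (Measurable.stronglyMeasurable fun _ _ => measurableSet_graphPath _).aestronglyMeasurable
  have hg0 : ∀ ω', 0 ≤ leafMean vs a S (x S ω') t := fun ω' =>
    leafMean_nonneg vs ha S (Nat.cast_nonneg (x S ω')) t
  have hset : ∀ s : Set GraphPath, MeasurableSet[Γ S] s →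
      ∫⁻ ω in s, ENNReal.ofReal (leafMean vs a S (x S ω) t) ∂μ =
        ∫⁻ ω in s, ENNReal.ofReal (x t ω) ∂μ := by
    intro s hs
    have hF : DependsUpTo S (s.indicator fun _ => (1 : ℝ≥0∞)) := by
      intro ω₁ ω₂ h
      have := dependsUpTo_mem_of_measurableSet hs ω₁ ω₂ h
      classical
      simp only [Set.indicator_apply]
      dsimp only at this
      simp only [this]
    have key := expect_mul_x (vs := vs) ha hSt htn hF
    rw [← lintegral_indicator (measurableSet_graphPath s),
      ← lintegral_indicator (measurableSet_graphPath s), hlin, hlin]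
    convert key.symm using 2 <;>
    · funext ω'
      by_cases h : ω' ∈ s <;> simp [h]
  have hxint : Integrable (fun ω => (x t ω : ℝ)) μ := by
    refine Integrable.of_mem_Icc 0 (t + 1) (Measurable.aemeasurable fun _ _ =>
      measurableSet_graphPath _) ?_
    refine (ae_toMeasure_iff measurableSet_graphPath _ _).2 fun ω' hω' => ⟨by positivity, ?_⟩
    have h1 : x t ω' ≤ (ω' t).numV := by
      simpa [x, MGraph.numLeaves] using Finset.card_filter_le (Finset.range (ω' t).numV) fun u => (ω' t).degree u = 1
    rw [(reachable_of_mem_support ha hω' htn).numV_eq] at h1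
    exact_mod_cast h1.trans (v_le vs t)
  have hgint : Integrable (fun ω => leafMean vs a S (x S ω) t) μ := by
    refine ⟨hmeas _, ?_⟩
    rw [hasFiniteIntegral_iff_ofReal (ae_of_all _ hg0)]
    have h1 := hset Set.univ MeasurableSet.univ
    simp only [Measure.restrict_univ] at h1
    rw [h1]
    exact (hasFiniteIntegral_iff_ofReal (ae_of_all _ fun _ => Nat.cast_nonneg _)).1 hxint.2
  have hle : Γ S ≤ (⊤ : MeasurableSpace GraphPath) := le_top
  have hae : (fun ω => leafMean vs a S (x S ω) t) =ᵐ[μ] μ[fun ω' => (x t ω' : ℝ) | Γ S] := by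
    refine ae_eq_condExp_of_forall_setIntegral_eq hle hxint
      (fun s _ _ => hgint.integrableOn) (fun s hs _ => ?_) ?_
    · rw [integral_eq_lintegral_of_nonneg_ae (ae_of_all _ hg0) (hmeas _).restrict,
        integral_eq_lintegral_of_nonneg_ae (ae_of_all _ fun _ => Nat.cast_nonneg _)
          (hmeas _).restrict, hset s hs]
    · have h1 : Measurable[Γ S] fun ω => leafMean vs a S (x S ω) t :=
        (measurable_of_countable fun k : ℕ => leafMean vs a S k t).comp
          (measurable_x_filtration S)
      exact h1.stronglyMeasurable.aestronglyMeasurable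
  exact ((ae_toMeasure_iff measurableSet_graphPath _ _).1 hae ω hω).symm

theorem constOn_gt {b : ℝ} (hb : -1 < b) (ha : ∀ t, -1 < a t) (t₀ t₁ t : ℕ) :
    -1 < constOn a t₀ t₁ b t := by
  unfold constOn; split_ifs
  · exact hb
  · exact ha t

/-- The left side is a conditional expectation under a different law, determined only on the support
of that law; it can be evaluated at ω because both laws have the same possible trajectories. -/
theorem f_eq_xhat (ha : ∀ t, -1 < a t) {b : ℝ} (hb : -1 < b) {S t n : ℕ} (hSt : S ≤ t)
    (htn : t ≤ n) {ω : GraphPath} (hω : ω ∈ (pathPMF vs a n).support) :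
    f vs a n S t b ω = xhat vs b S ω t := by
  have hc := constOn_gt hb ha S t
  rw [f, condMean_eq_leafMean hc hSt htn (mem_support_pathPMF_of_mem ha hc hω),
    xhat_eq_leafMean]
  refine leafMean_congr vs _ fun s h1 h2 => ?_
  rw [constOn, if_pos ⟨h1.le, h2⟩]

end Mean

/-! ### Sub-Gaussian concentration around the conditional mean -/

section Concentration

variable {vs : ℕ → Bool} {a : ℕ → ℝ}

/-- Hoeffding's lemma for a variable with range of length 3: the constant is (3/2)² / 2 = 9/8. -/
theorem Reachable.expect_exp_le {t : ℕ} {G : MGraph} (hG : Reachable vs t G) {b : ℝ}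
    (hb : -1 < b) (θ : ℝ) :
    expect (step b (vs (t + 1)) G) (fun G' => ENNReal.ofReal (Real.exp
      (θ * (G'.numLeaves - (decay vs b (t + 1) * G.numLeaves + y vs (t + 1)))))) ≤
      ENNReal.ofReal (Real.exp (9 / 8 * θ ^ 2)) := by
  let _ : MeasurableSpace MGraph := ⊤
  have htop : ∀ s : Set MGraph, MeasurableSet s := fun _ => MeasurableSpace.measurableSet_top
  set μ := (step b (vs (t + 1)) G).toMeasure
  set X : MGraph → ℝ := fun G' => G'.numLeaves
  have hX : Measurable X := fun _ _ => htop _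
  have hA := decay_succ_nonneg vs t hb
  have hbd : ∀ᵐ G' ∂μ, X G' ∈ Set.Icc ((G.numLeaves : ℝ) - 2) (G.numLeaves + 1) :=
    (ae_toMeasure_iff htop _ _).2 fun G' hG' => hG.numLeaves_mem_Icc hb hG'
  have hmean : ∫ G', X G' ∂μ = decay vs b (t + 1) * G.numLeaves + y vs (t + 1) := by
    rw [integral_eq_lintegral_of_nonneg_ae (ae_of_all _ fun _ => Nat.cast_nonneg _)
      hX.aestronglyMeasurable, lintegral_toMeasure_eq_expect htop]
    simp only [ENNReal.ofReal_natCast]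
    rw [hG.expect_numLeaves hb, ENNReal.toReal_ofReal (by positivity)]
  have hsub := ProbabilityTheory.hasSubgaussianMGF_of_mem_Icc hX.aemeasurable hbd
  rw [hmean] at hsub
  have h1 := hsub.mgf_le θ
  have h2 := hsub.integrable_exp_mul θ
  rw [← lintegral_toMeasure_eq_expect htop,
    ← ofReal_integral_eq_lintegral_ofReal h2 (ae_of_all _ fun _ => (Real.exp_pos _).le)]
  refine ENNReal.ofReal_le_ofReal (h1.trans (Real.exp_le_exp.2 (le_of_eq ?_)))
  have h3 : (G.numLeaves : ℝ) + 1 - ((G.numLeaves : ℝ) - 2) = 3 := by ring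
  simp only [h3]
  push_cast
  norm_num
  ring

/-- The deviation at time t + 1 is A times the deviation at time t plus a centred increment, where A
is the decay factor. The induction hypothesis is used at θ A instead of θ, and 0 ≤ A ≤ 1 keeps old
errors from being amplified. -/
theorem expect_exp_le (ha : ∀ t, -1 < a t) {S t n : ℕ} (hSt : S ≤ t) (htn : t ≤ n) (θ : ℝ) :
    expect (pathPMF vs a n) (fun ω => ENNReal.ofReal (Real.exp
      (θ * (x t ω - leafMean vs a S (x S ω) t)))) ≤
      ENNReal.ofReal (Real.exp (9 / 8 * θ ^ 2 * (t - S))) := by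
  have hdep : ∀ (θ : ℝ) (t : ℕ), S ≤ t → DependsUpTo t (fun ω => ENNReal.ofReal (Real.exp
      (θ * (x t ω - leafMean vs a S (x S ω) t)))) := by
    intro θ t hSt ω ω' h
    have h1 := dependsUpTo_leafMean (vs := vs) (a := a) hSt id t ω ω' h
    simp only [id] at h1
    simp only [dependsUpTo_x t ω ω' h, h1]
  rw [expect_pathPMF_of_le htn (hdep θ t hSt)]
  clear htn
  induction t, hSt using Nat.le_induction generalizing θ with
  | base => simp [leafMean_of_le vs a _ le_rfl, expect_const]
  | succ t hSt ih =>
    set A := decay vs (a (t + 1)) (t + 1) with hAdef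
    have hA0 : 0 ≤ A := decay_succ_nonneg vs t (ha (t + 1))
    have hA1 : A ≤ 1 := decay_succ_le_one vs t (ha (t + 1))
    let F : GraphPath → ℝ≥0∞ := fun ω => ENNReal.ofReal (Real.exp
      (θ * A * (x t ω - leafMean vs a S (x S ω) t)))
    let φ : GraphPath → MGraph → ℝ≥0∞ := fun ω G => ENNReal.ofReal (Real.exp
      (θ * (G.numLeaves - (A * (ω t).numLeaves + y vs (t + 1)))))
    have hφ : DependsUpTo t φ := by
      intro ω ω' h
      simp only [φ, h t le_rfl]
    have h1 := expect_pathPMF_mul (vs := vs) (a := a) t (hdep (θ * A) t hSt) φ hφ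
    have h2 : expect (pathPMF vs a (t + 1)) (fun ω => ENNReal.ofReal (Real.exp
        (θ * (x (t + 1) ω - leafMean vs a S (x S ω) (t + 1))))) =
        expect (pathPMF vs a (t + 1)) (fun ω => F ω * φ ω (ω (t + 1))) := by
      refine expect_congr fun ω _ => ?_
      simp only [F, φ]
      rw [← ENNReal.ofReal_mul (Real.exp_pos _).le, ← Real.exp_add, leafMean_succ vs a _ hSt]
      simp only [x]
      congr 2
      ring
    rw [h2]
    refine h1.le.trans ?_
    refine (expect_mono (F' := fun ω => ENNReal.ofReal (Real.exp (9 / 8 * θ ^ 2)) * F ω)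
      fun ω hω => ?_).trans ?_
    · rw [mul_comm]
      gcongr
      exact (reachable_of_mem_support ha hω le_rfl).expect_exp_le (ha _) θ
    · rw [expect_mul_left]
      refine (mul_le_mul_right (ih (θ * A)) _).trans ?_
      rw [← ENNReal.ofReal_mul (Real.exp_pos _).le, ← Real.exp_add]
      refine ENNReal.ofReal_le_ofReal (Real.exp_le_exp.2 ?_)
      have h3 : (θ * A) ^ 2 ≤ θ ^ 2 := by
        rw [mul_pow]
        exact mul_le_of_le_one_right (sq_nonneg _) (pow_le_one₀ hA0 hA1)
      have h4 : (0 : ℝ) ≤ (t : ℝ) - S := sub_nonneg.2 (by exact_mod_cast hSt)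
      push_cast
      nlinarith [mul_le_mul_of_nonneg_right h3 h4]

theorem law_deviation_le (ha : ∀ t, -1 < a t) {S t n : ℕ} (hSt : S ≤ t) (htn : t ≤ n) {θ : ℝ}
    (hθ : 0 < θ) (r : ℝ) :
    law vs a n {ω | r ≤ |(x t ω : ℝ) - leafMean vs a S (x S ω) t|} ≤
      2 * ENNReal.ofReal (Real.exp (9 / 8 * θ ^ 2 * n - θ * r)) := by
  have htS : (t : ℝ) - S ≤ n := by
    have : (t : ℝ) ≤ n := by exact_mod_cast htn
    linarith [(Nat.cast_nonneg S : (0 : ℝ) ≤ S)]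
  -- Chernoff's bound, to be applied with η = θ and η = -θ for the two tails.
  have key : ∀ η : ℝ, η ^ 2 = θ ^ 2 →
      law vs a n {ω | θ * r ≤ η * ((x t ω : ℝ) - leafMean vs a S (x S ω) t)} ≤
        ENNReal.ofReal (Real.exp (9 / 8 * θ ^ 2 * n - θ * r)) := by
    intro η hη
    have h1 := mul_meas_ge_le_lintegral (μ := law vs a n)
      (f := fun ω => ENNReal.ofReal (Real.exp (η * (x t ω - leafMean vs a S (x S ω) t))))
      (fun _ _ => measurableSet_graphPath _) (ENNReal.ofReal (Real.exp (θ * r)))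
    rw [law, lintegral_toMeasure_eq_expect measurableSet_graphPath] at h1
    have h2 := h1.trans (expect_exp_le ha hSt htn η)
    rw [hη] at h2
    simp only [ENNReal.ofReal_le_ofReal_iff (Real.exp_pos _).le, Real.exp_le_exp] at h2
    rw [Real.exp_sub, ENNReal.ofReal_div_of_pos (Real.exp_pos _),
      ENNReal.le_div_iff_mul_le (Or.inl (ENNReal.ofReal_pos.2 (Real.exp_pos _)).ne')
        (Or.inl ENNReal.ofReal_ne_top), mul_comm]
    refine h2.trans (ENNReal.ofReal_le_ofReal (Real.exp_le_exp.2 ?_))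
    gcongr
  rw [two_mul]
  refine (measure_mono ?_).trans ((measure_union_le _ _).trans
    (add_le_add (key θ rfl) (key (-θ) (neg_sq θ))))
  intro ω hω
  rcases le_abs.1 (show r ≤ |_| from hω) with h | h
  · left
    exact mul_le_mul_of_nonneg_left h hθ.le
  · right
    change θ * r ≤ _
    rw [neg_mul, ← mul_neg]
    exact mul_le_mul_of_nonneg_left h hθ.le

end Concentration

end PrefAttach

/-! ### Uniform deviation bound and comparison of maximizers -/

namespace PrefAttach

open scoped ENNReal

/-- With high probability, the number of leaves stays uniformly close to its conditional mean. -/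
theorem law_exists_deviation_le {vs : ℕ → Bool} {a : ℕ → ℝ} (ha : ∀ t, -1 < a t) (S : ℕ) {n : ℕ}
    (hn : 0 < n) :
    law vs a n {ω | ∃ t, S ≤ t ∧ t ≤ n ∧ 2 * Real.sqrt n * Real.log n ≤
      |(x t ω : ℝ) - leafMean vs a S (x S ω) t|} ≤
      ENNReal.ofReal (4 * Real.exp (9 / 8) / n) := by
  have hn' : (0 : ℝ) < n := by exact_mod_cast hn
  have hs : 0 < Real.sqrt n := Real.sqrt_pos.2 hn'
  -- The choice θ = 1/√n turns the exponent into 9/8 - 2 log n; the resulting factor n⁻² survives a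
  -- union bound over at most 2n times.
  have hexp : Real.exp (9 / 8 * (1 / Real.sqrt n) ^ 2 * n -
      1 / Real.sqrt n * (2 * Real.sqrt n * Real.log n)) = Real.exp (9 / 8) / (n : ℝ) ^ 2 := by
    have h1 : 9 / 8 * (1 / Real.sqrt n) ^ 2 * n = 9 / 8 := by
      rw [div_pow, Real.sq_sqrt hn'.le]
      field_simp
    have h2 : 1 / Real.sqrt n * (2 * Real.sqrt n * Real.log n) = Real.log ((n : ℝ) ^ 2) := by
      rw [Real.log_pow]
      field_simp
      push_cast
      ring
    rw [h1, h2, Real.exp_sub, Real.exp_log (by positivity)]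
  have hsub : {ω | ∃ t, S ≤ t ∧ t ≤ n ∧ 2 * Real.sqrt n * Real.log n ≤
      |(x t ω : ℝ) - leafMean vs a S (x S ω) t|} ⊆
      ⋃ t ∈ Finset.Icc S n, {ω | 2 * Real.sqrt n * Real.log n ≤
        |(x t ω : ℝ) - leafMean vs a S (x S ω) t|} := by
    rintro ω ⟨t, h1, h2, h3⟩
    exact Set.mem_biUnion (Finset.mem_coe.2 (Finset.mem_Icc.2 ⟨h1, h2⟩)) h3
  refine (measure_mono hsub).trans ((measure_biUnion_finset_le _ _).trans ?_)
  refine (Finset.sum_le_sum fun t ht => law_deviation_le ha (Finset.mem_Icc.1 ht).1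
    (Finset.mem_Icc.1 ht).2 (one_div_pos.2 hs) _).trans ?_
  rw [hexp, Finset.sum_const, nsmul_eq_mul, ← ENNReal.ofReal_natCast, ← ENNReal.ofReal_ofNat,
    ← ENNReal.ofReal_mul (by norm_num), ← ENNReal.ofReal_mul (by positivity)]
  refine ENNReal.ofReal_le_ofReal ?_
  have hcard : ((Finset.Icc S n).card : ℝ) ≤ 2 * n := by
    have : (Finset.Icc S n).card ≤ 2 * n := by rw [Nat.card_Icc]; omega
    exact_mod_cast this
  calc ((Finset.Icc S n).card : ℝ) * (2 * (Real.exp (9 / 8) / (n : ℝ) ^ 2))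
      ≤ 2 * n * (2 * (Real.exp (9 / 8) / (n : ℝ) ^ 2)) := by gcongr
    _ = 4 * Real.exp (9 / 8) / n := by field_simp; norm_num

/-- If two functions are uniformly close and one of them is linearly separated from its maximum,
then the maximizers are close. -/
theorem mul_abs_sub_le_of_isArgmax {g g' : ℕ → ℝ} {S T k r : ℕ} {c D : ℝ}
    (hclose : ∀ t, S ≤ t → t ≤ T → |g' t - g t| ≤ D) (hk : IsArgmax g' S T k)
    (hr : IsArgmax g S T r) (hsep : c * |(k : ℝ) - r| ≤ g r - g k) :
    c * |(k : ℝ) - r| ≤ 2 * D := by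
  have h1 := abs_le.1 (hclose k hk.1.1.le hk.1.2.le)
  have h2 := abs_le.1 (hclose r hr.1.1.le hr.1.2.le)
  have h3 : g' r ≤ g' k := hk.2 hr.1
  linarith

end PrefAttach

open PrefAttach in
theorem theorem3p3
    -- the types of the steps (vertex-steps are `true`) and the parameters `a_t`, at horizon `T`
    (vs : ℕ → ℕ → Bool) (a : ℕ → ℕ → ℝ)
    (ha : ∀ T t, -1 < a T t) (ha_bdd : ∀ T, BddAbove (Set.range (a T)))
    -- the number of vertices is at least of order `t`
    (p : ℝ) (hp : 0 < p) (hv : ∀ T t, 0 < t → p ≤ (PrefAttach.v (vs T) t : ℝ) / t)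
    -- one change point `R` in `[S, T]`, away from both ends
    (S R : ℕ → ℕ) (α₁ α₂ : ℝ) (hα : 0 < |α₂ - α₁|)
    (hSRT : ∀ᶠ T in atTop, S T < R T ∧ R T < T)
    (ha₁ : ∀ᶠ T in atTop, ∀ t, S T ≤ t → t < R T → a T t = α₁)
    (ha₂ : ∀ᶠ T in atTop, ∀ t, R T ≤ t → t ≤ T → a T t = α₂)
    (ρ₁ ρ₂ : ℝ) (hρ₁ : 0 < ρ₁) (hρ₂ : 0 < ρ₂)
    (hTR : Tendsto (fun T : ℕ => ((T : ℝ) - R T) / T) atTop (𝓝 ρ₁))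
    (hRS : Tendsto (fun T : ℕ => ((R T : ℝ) - S T) / T) atTop (𝓝 ρ₂))
    -- the estimator of the parameter on `[S, T]`: a minimizer whenever there is one
    (ahat : ℕ → PrefAttach.GraphPath → ℝ) (hahat_mem : ∀ T ω, -1 < ahat T ω)
    (hahat : ∀ T ω, (∃ b, PrefAttach.IsArgminLoss (vs T) (a T) (S T) T ω b) →
      PrefAttach.IsArgminLoss (vs T) (a T) (S T) T ω (ahat T ω))
    -- `Rhat` maximizes `h` over `(S, T)`
    (Rhat : ℕ → PrefAttach.GraphPath → ℕ)
    (hRhat : ∀ᶠ T in atTop, ∀ ω, PrefAttach.IsArgmax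
      (PrefAttach.h (vs T) (a T) (S T) T (ahat T ω) ω) (S T) T (Rhat T ω))
    -- linear separation, with probability tending to one
    (c : ℝ) (hc : 0 < c)
    (hsep : Tendsto (fun T : ℕ => PrefAttach.law (vs T) (a T) T
        {ω | ∀ t, S T ≤ t → t ≤ T →
          c * |(t : ℝ) - (Rhat T ω : ℝ)| ≤
            PrefAttach.h (vs T) (a T) (S T) T (ahat T ω) ω (Rhat T ω) -
              PrefAttach.h (vs T) (a T) (S T) T (ahat T ω) ω t}) atTop (𝓝 1))
    -- the location estimator: one plus a maximizer of the fitting error over `(S, T)`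
    (τhat : ℕ → PrefAttach.GraphPath → ℕ)
    (hτhat : ∀ᶠ T in atTop, ∀ ω, ∃ k, PrefAttach.IsArgmax
      (fun t => |PrefAttach.xhat (vs T) (ahat T ω) (S T) ω t - (PrefAttach.x t ω : ℝ)|)
      (S T) T k ∧ τhat T ω = k + 1) :
    PrefAttach.IsBigOp (fun T => PrefAttach.law (vs T) (a T) T)
      (fun T ω => |(τhat T ω : ℝ) - 1 - (Rhat T ω : ℝ)| / (T : ℝ))
      (fun T => Real.log (T : ℝ) / (T : ℝ) ^ (1 / 2 : ℝ)) := by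
  intro ε hε
  -- From c |k - R̂| ≤ 2D with D = 2 √T log T, after division by c T. The same constant serves every
  -- ε.
  refine ⟨4 / c, by positivity, ?_⟩
  set sep : ℕ → Set GraphPath := fun T => {ω | ∀ t, S T ≤ t → t ≤ T →
    c * |(t : ℝ) - (Rhat T ω : ℝ)| ≤
      PrefAttach.h (vs T) (a T) (S T) T (ahat T ω) ω (Rhat T ω) -
        PrefAttach.h (vs T) (a T) (S T) T (ahat T ω) ω t}
  have hlim : Tendsto (fun T : ℕ => (1 - law (vs T) (a T) T (sep T)) +
      ENNReal.ofReal (4 * Real.exp (9 / 8) / T)) atTop (𝓝 0) := by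
    have h1 : Tendsto (fun T : ℕ => 1 - law (vs T) (a T) T (sep T)) atTop (𝓝 0) := by
      simpa using ENNReal.Tendsto.sub tendsto_const_nhds hsep (Or.inl ENNReal.one_ne_top)
    have h2 : Tendsto (fun T : ℕ => ENNReal.ofReal (4 * Real.exp (9 / 8) / T)) atTop (𝓝 0) := by
      simpa using ENNReal.tendsto_ofReal (tendsto_const_div_atTop_nhds_zero_nat _)
    simpa using h1.add h2
  have hsmall := hlim.eventually_le_const (ENNReal.ofReal_pos.2 hε)
  filter_upwards [hsmall, hRhat, hτhat, eventually_gt_atTop 0] with T hT hR hτ hT0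
  refine le_trans ?_ hT
  have hT0' : (0 : ℝ) < T := by exact_mod_cast hT0
  set μ := law (vs T) (a T) T
  set D : ℝ := 2 * Real.sqrt T * Real.log T with hD
  set dev : Set GraphPath := {ω | ∃ t, S T ≤ t ∧ t ≤ T ∧ D ≤
    |(x t ω : ℝ) - leafMean (vs T) (a T) (S T) (x (S T) ω) t|}
  set supp : Set GraphPath := (pathPMF (vs T) (a T) T).support
  -- The formulas for the conditional means hold only on the support, so its null complement joins
  -- the exceptional set.
  have hsupp : μ suppᶜ = 0 :=
    (ae_toMeasure_iff measurableSet_graphPath _ (· ∈ supp)).2 fun _ h => h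
  have hcompl : μ (sep T)ᶜ = 1 - μ (sep T) :=
    prob_compl_eq_one_sub (measurableSet_graphPath _)
  have hcover : {ω | 4 / c * (Real.log (T : ℝ) / (T : ℝ) ^ (1 / 2 : ℝ)) <
      |(|(τhat T ω : ℝ) - 1 - (Rhat T ω : ℝ)| / (T : ℝ))|} ⊆ ((sep T)ᶜ ∪ dev) ∪ suppᶜ := by
    intro ω hω
    by_contra hnot
    simp only [Set.mem_union, Set.mem_compl_iff, not_or, not_not] at hnot
    obtain ⟨⟨hωsep, hωdev⟩, hωsupp⟩ := hnot
    obtain ⟨k, hk, hkτ⟩ := hτ ω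
    have hclose : ∀ t, S T ≤ t → t ≤ T →
        |(|xhat (vs T) (ahat T ω) (S T) ω t - (x t ω : ℝ)|) -
          PrefAttach.h (vs T) (a T) (S T) T (ahat T ω) ω t| ≤ D := by
      intro t h1 h2
      have h3 : |(x t ω : ℝ) - leafMean (vs T) (a T) (S T) (x (S T) ω) t| < D := by
        by_contra h
        exact hωdev ⟨t, h1, h2, not_lt.1 h⟩
      -- With both conditional means explicit, `xhat` cancels by the reverse triangle inequality and
      -- only the deviation of x_t from its true mean is left.
      rw [PrefAttach.h, f_eq_xhat (ha T) (hahat_mem T ω) h1 h2 hωsupp,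
        condMean_eq_leafMean (ha T) h1 h2 hωsupp, abs_sub_comm _ (x t ω : ℝ)]
      refine (abs_abs_sub_abs_le_abs_sub _ _).trans (le_trans (le_of_eq ?_) h3.le)
      congr 1
      ring
    have hmain := mul_abs_sub_le_of_isArgmax hclose hk (hR ω) (hωsep k hk.1.1.le hk.1.2.le)
    have hω' : 4 / c * (Real.log (T : ℝ) / (T : ℝ) ^ (1 / 2 : ℝ)) <
      |(|(τhat T ω : ℝ) - 1 - (Rhat T ω : ℝ)| / (T : ℝ))| := hω
    rw [hkτ, Nat.cast_succ, add_sub_cancel_right, abs_of_nonneg (by positivity),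
      ← Real.sqrt_eq_rpow, lt_div_iff₀ hT0'] at hω'
    have hs : 0 < Real.sqrt T := Real.sqrt_pos.2 hT0'
    have hrw : 4 / c * (Real.log (T : ℝ) / Real.sqrt T) * T = 2 * D / c := by
      calc 4 / c * (Real.log (T : ℝ) / Real.sqrt T) * T
          = 4 / c * Real.log T * (T / Real.sqrt T) := by ring
        _ = 2 * D / c := by rw [Real.div_sqrt, hD]; ring
    rw [hrw, div_lt_iff₀ hc] at hω'
    linarith
  calc _ ≤ μ (((sep T)ᶜ ∪ dev) ∪ suppᶜ) := measure_mono hcover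
    _ ≤ μ (sep T)ᶜ + μ dev + μ suppᶜ :=
      (measure_union_le _ _).trans (add_le_add (measure_union_le _ _) le_rfl)
    _ ≤ _ := by
      rw [hsupp, add_zero, hcompl]
      gcongr
      exact law_exists_deviation_le (ha T) (S T) hT0
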